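/- Let $k$ be a number field and let $(\mathcal E,\rho,\sigma)$ be an isotrivial rational elliptic surface with base $\mathbb P^1_k$: $\mathcal E$ is a smooth proper geometrically integral surface over $k$, $\rho:\mathcal E\to\mathbb P^1_k$ is a relatively minimal elliptic fibration with section $\sigma$ and with at least one geometrically singular fibre, $\mathcal E_{\bar k}$ is birational to $\mathbb P^2_{\bar k}$, and the $j$-invariant of the generic fibre $E/k(T)$ lies in $k$. Let $$Y^2=X^3+a(T)X+b(T),\qquad a,b\in k[T],\quad \deg a\le 4,\ \deg b\le 6,\ 4a^3+27b^2\notin k,$$ be a Weierstrass equation of $E$ (with origin given by $\sigma$), and let $X$ be the associated sextic hypersurface $$w^2=z^3+y^4a(x/y)\,z+y^6b(x/y)$$ in $\mathbb P_k(1,1,2,3)=\operatorname{Proj}k[x,y,z,w]$. Suppose that $X$ is smooth over $k$. Then there is a squarefree homogeneous form $F(x,y)\in k[x,y]$ of degree $6$ such that $X$ is isomorphic over $k$ to the hypersurface $$w^2=z^3+F(x,y)$$ in $\mathbb P_k(1,1,2,3)$. Moreover $F$ can be chosen such that $E$ (with origin given by $\sigma$) has the Weierstrass equation $Y^2=X^3+f(T)$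 with $f(T)=F(T,1)$; here $f$ is squarefree, is not a square in $k[T]$, and $1\le\deg f\le 6$, so $\mathcal E$ is a family of sextic twists. -/

import Mathlib

open CategoryTheory CategoryTheory.Limits AlgebraicGeometry

universe u

noncomputable section

namespace RatEllSurf

attribute [local instance] MvPolynomial.weightedGradedAlgebra

/-! ### Projective spectra of graded algebras over a field -/

/-- The structure morphism `Proj A ⟶ Spec K` of a graded `K`-algebra `A`. -/
def projStr {K A : Type u} [Field K] [CommRing A] [Algebra K A] (𝒜 : ℕ → Submodule K A)
    [GradedAlgebra 𝒜] : Proj 𝒜 ⟶ Spec (.of K) :=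
  Proj.toSpecZero 𝒜 ≫ Spec.map (CommRingCat.ofHom (algebraMap K (𝒜 0)))

/-- The weighted projective space with weights `w` over `K`. -/
abbrev WPSpace (K : Type u) [Field K] {n : ℕ} (w : Fin n → ℕ) : Scheme.{u} :=
  Proj (MvPolynomial.weightedHomogeneousSubmodule K w)

/-- Projective `n`-space over `K`. -/
abbrev PSpace (K : Type u) [Field K] (n : ℕ) : Scheme.{u} :=
  WPSpace K (fun _ : Fin (n + 1) => 1)

/-- The structure morphism of projective `n`-space over `K`. -/
abbrev PSpace.str (K : Type u) [Field K] (n : ℕ) : PSpace K n ⟶ Spec (.of K) :=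
  projStr (MvPolynomial.weightedHomogeneousSubmodule K (fun _ : Fin (n + 1) => 1))

/-! ### Hypersurfaces in weighted projective spaces -/

/-- Weighted homogeneous polynomials of degree `d`, for the weights `w` of the variables. -/
structure WForm (K : Type u) [Field K] {n : ℕ} (w : Fin n → ℕ) (d : ℕ) where
  poly : MvPolynomial (Fin n) K
  homog : MvPolynomial.IsWeightedHomogeneous w poly d

namespace WForm

variable {K : Type u} [Field K] {n : ℕ} {w : Fin n → ℕ} {d : ℕ} (f : WForm K w d)

/-- The homogeneous coordinate ring of the hypersurface `f = 0`. -/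
abbrev CoordRing : Type u := MvPolynomial (Fin n) K ⧸ Ideal.span {f.poly}

/-- The grading of the homogeneous coordinate ring: the degree `i` part is the image of the
weighted homogeneous polynomials of degree `i`. -/
def grading (i : ℕ) : Submodule K f.CoordRing :=
  (MvPolynomial.weightedHomogeneousSubmodule K w i).map
    (Ideal.Quotient.mkₐ K (Ideal.span {f.poly})).toLinearMap

lemma mk_mem_grading {i : ℕ} {p : MvPolynomial (Fin n) K}
    (hp : p ∈ MvPolynomial.weightedHomogeneousSubmodule K w i) :
    Ideal.Quotient.mkₐ K (Ideal.span {f.poly}) p ∈ f.grading i :=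
  ⟨p, hp, rfl⟩

instance : SetLike.GradedMonoid f.grading where
  one_mem := f.mk_mem_grading (MvPolynomial.isWeightedHomogeneous_one K w)
  mul_mem := by
    rintro i j _ _ ⟨p, hp, rfl⟩ ⟨q, hq, rfl⟩
    exact f.mk_mem_grading (MvPolynomial.IsWeightedHomogeneous.mul hp hq)

/-- Reduction modulo `f` in degree `i`. -/
def gradedMk (i : ℕ) : MvPolynomial.weightedHomogeneousSubmodule K w i →ₗ[K] f.grading i :=
  ((Ideal.Quotient.mkₐ K (Ideal.span {f.poly})).toLinearMap.comp
    (MvPolynomial.weightedHomogeneousSubmodule K w i).subtype).codRestrict (f.grading i)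
    fun p => f.mk_mem_grading p.2

/-- Reduction modulo `f`, on the direct sum of the graded parts. -/
def sumMk : DirectSum ℕ (fun i => MvPolynomial.weightedHomogeneousSubmodule K w i) →ₐ[K]
    DirectSum ℕ (fun i => f.grading i) :=
  DirectSum.toAlgebra K (fun i => MvPolynomial.weightedHomogeneousSubmodule K w i)
    (fun i => (DirectSum.lof K ℕ (fun i => f.grading i) i).comp (f.gradedMk i))
    (by rfl)
    (fun {i j} x y => by
      simp only [LinearMap.comp_apply, DirectSum.lof_eq_of, DirectSum.of_mul_of]
      rfl)

lemma sumMk_of (i : ℕ) (x : MvPolynomial.weightedHomogeneousSubmodule K w i) :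
    f.sumMk (DirectSum.of (fun i => MvPolynomial.weightedHomogeneousSubmodule K w i) i x) =
      DirectSum.of (fun i => f.grading i) i (f.gradedMk i x) :=
  DirectSum.toAddMonoid_of _ _ _

/-- The decomposition of a polynomial into the classes of its homogeneous components. -/
def preDecompose : MvPolynomial (Fin n) K →ₐ[K] DirectSum ℕ (fun i => f.grading i) :=
  f.sumMk.comp
    (DirectSum.decomposeAlgEquiv (MvPolynomial.weightedHomogeneousSubmodule K w)).toAlgHom

lemma preDecompose_of_mem {i : ℕ} (p : MvPolynomial (Fin n) K)
    (hp : p ∈ MvPolynomial.weightedHomogeneousSubmodule K w i) :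
    f.preDecompose p = DirectSum.of (fun i => f.grading i) i ⟨_, f.mk_mem_grading hp⟩ := by
  have h : DirectSum.decompose (MvPolynomial.weightedHomogeneousSubmodule K w) p
      = DirectSum.of (fun i => MvPolynomial.weightedHomogeneousSubmodule K w i) i ⟨p, hp⟩ :=
    DirectSum.decompose_of_mem _ hp
  exact (congrArg f.sumMk h).trans (f.sumMk_of i ⟨p, hp⟩)

/-- The decomposition of the homogeneous coordinate ring into its graded parts. -/
def decomp : f.CoordRing →ₐ[K] DirectSum ℕ (fun i => f.grading i) :=
  Ideal.Quotient.liftₐ _ f.preDecompose <| by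
    intro a ha
    obtain ⟨b, rfl⟩ := Ideal.mem_span_singleton.mp ha
    have h0 : f.preDecompose f.poly = 0 := by
      rw [f.preDecompose_of_mem f.poly f.homog]
      convert map_zero (DirectSum.of (fun i => f.grading i) d)
      exact Ideal.Quotient.eq_zero_iff_mem.mpr (Ideal.mem_span_singleton_self _)
    rw [map_mul, h0, zero_mul]

instance : GradedAlgebra f.grading :=
  GradedAlgebra.ofAlgHom f.grading f.decomp
    (by
      refine Ideal.Quotient.algHom_ext _ (MvPolynomial.algHom_ext fun j => ?_)
      change DirectSum.coeAlgHom f.grading (f.preDecompose (MvPolynomial.X j)) = _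
      rw [f.preDecompose_of_mem _ (MvPolynomial.isWeightedHomogeneous_X K w j),
        DirectSum.coeAlgHom_of]
      rfl)
    (by
      rintro i ⟨_, p, hp, rfl⟩
      exact f.preDecompose_of_mem p hp)

/-- The hypersurface `f = 0` in the weighted projective space with weights `w`. -/
abbrev hypersurface : Scheme.{u} := Proj f.grading

/-- The structure morphism of the hypersurface `f = 0`. -/
abbrev str : f.hypersurface ⟶ Spec (.of K) := projStr f.grading

end WForm

/-- The plane projective cubic given by a Weierstrass equation. -/
def weierstrassForm {K : Type u} [Field K] (W : WeierstrassCurve K) :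
    WForm K (fun _ : Fin 3 => 1) 3 where
  poly := W.toProjective.polynomial
  homog := by
    have hX : ∀ (j : Fin 3) (m : ℕ), MvPolynomial.IsHomogeneous
        (MvPolynomial.X j ^ m : MvPolynomial (Fin 3) K) m := MvPolynomial.isHomogeneous_X_pow
    have hx : ∀ j : Fin 3, MvPolynomial.IsHomogeneous
        (MvPolynomial.X j : MvPolynomial (Fin 3) K) 1 := MvPolynomial.isHomogeneous_X K
    have hC : ∀ c : K, MvPolynomial.IsHomogeneous
        (MvPolynomial.C c : MvPolynomial (Fin 3) K) 0 := MvPolynomial.isHomogeneous_C _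
    change MvPolynomial.IsHomogeneous _ 3
    rw [WeierstrassCurve.Projective.polynomial]
    refine ((((hX 1 2).mul (hx 2)).add ((((hC _).mul (hx 0)).mul (hx 1)).mul (hx 2))).add
      (((hC _).mul (hx 1)).mul (hX 2 2))).sub ((((hX 0 3).add
      (((hC _).mul (hX 0 2)).mul (hx 2))).add (((hC _).mul (hx 0)).mul (hX 2 2))).add
      ((hC _).mul (hX 2 3)))

/-! ### Elliptic surfaces over the projective line -/

section

variable (k : Type u) [Field k]

/-- The homomorphism `K[x, y]_{(y)} → K(T)` (degree `0` part of the localization at `y`) that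
sends `x / y` to `T`. -/
def awayToRatFunc :
    HomogeneousLocalization.Away
      (MvPolynomial.weightedHomogeneousSubmodule k (fun _ : Fin (1 + 1) => 1))
      (MvPolynomial.X 1) →+* RatFunc k :=
  (IsLocalization.Away.lift (S := Localization.Away (MvPolynomial.X 1 : MvPolynomial (Fin 2) k))
    (MvPolynomial.X 1 : MvPolynomial (Fin 2) k)
    (g := (MvPolynomial.aeval ![(RatFunc.X : RatFunc k), 1]).toRingHom)
    (by simp)).comp
  (algebraMap _ _)

/-- The generic point `[T : 1]` of the projective line, as a morphism `Spec k(T) ⟶ ℙ¹`. -/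
def genericPt : Spec (.of (RatFunc k)) ⟶ PSpace k 1 :=
  Spec.map (CommRingCat.ofHom (awayToRatFunc k)) ≫
    Proj.awayι (MvPolynomial.weightedHomogeneousSubmodule k (fun _ : Fin (1 + 1) => 1))
      (MvPolynomial.X 1) (MvPolynomial.isWeightedHomogeneous_X k _ 1) one_pos

variable {k}

/-- Given a morphism `ρ : S ⟶ ℙ¹` with a section `σ`, the Weierstrass curve `W` over `k(T)` is a
Weierstrass equation of the generic fibre of `ρ`: there is an isomorphism over `k(T)` between the
generic fibre and the plane cubic `W`, which takes the point of the generic fibre given by `σ` to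
the point at infinity (the unique point of the cubic on the line `Z = 0`). -/
def IsGenericFibre {S : Scheme.{u}} (ρ : S ⟶ PSpace k 1) (σ : PSpace k 1 ⟶ S)
    (hσ : σ ≫ ρ = 𝟙 _) (W : WeierstrassCurve (RatFunc k)) : Prop :=
  ∃ e : pullback ρ (genericPt k) ≅ (weierstrassForm W).hypersurface,
    e.hom ≫ (weierstrassForm W).str = pullback.snd ρ (genericPt k) ∧
    ∀ t, Ideal.Quotient.mk _ (MvPolynomial.X 2) ∈
      (((pullback.lift (genericPt k ≫ σ) (𝟙 _) (by simp [hσ]) :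
        Spec (.of (RatFunc k)) ⟶ pullback ρ (genericPt k)) ≫ e.hom) t).asHomogeneousIdeal

/-- `f : S ⟶ S'` is birational: it is an isomorphism above a dense open subset of `S'`
whose preimage is dense. -/
def IsBirationalMorphism {S S' : Scheme.{u}} (f : S ⟶ S') : Prop :=
  ∃ U : S'.Opens, Dense (U : Set S') ∧ Dense ((f ⁻¹ᵁ U : S.Opens) : Set S) ∧ IsIso (f ∣_ U)

variable (k) in
/-- Elliptic surfaces with base the projective line over `k`. -/
structure EllipticSurface where
  /-- the total space -/
  S : Scheme.{u}
  /-- the fibration -/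
  ρ : S ⟶ PSpace k 1
  /-- the section -/
  σ : PSpace k 1 ⟶ S
  section_eq : σ ≫ ρ = 𝟙 _
  /-- the total space is a smooth, proper, geometrically integral surface over `k` -/
  smooth : SmoothOfRelativeDimension 2 (ρ ≫ PSpace.str k 1)
  proper : IsProper (ρ ≫ PSpace.str k 1)
  integral : GeometricallyIntegral (ρ ≫ PSpace.str k 1)
  /-- the generic fibre, with the origin given by the section, is an elliptic curve -/
  elliptic : ∃ W : WeierstrassCurve (RatFunc k), W.IsElliptic ∧ IsGenericFibre ρ σ section_eq W
  /-- relative minimality: every birational morphism over the base onto a smooth proper surface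
  is an isomorphism -/
  minimal : ∀ (S' : Scheme.{u}) (ρ' : S' ⟶ PSpace k 1) (f : S ⟶ S'), f ≫ ρ' = ρ →
    SmoothOfRelativeDimension 2 (ρ' ≫ PSpace.str k 1) → IsProper (ρ' ≫ PSpace.str k 1) →
    IsBirationalMorphism f → IsIso f
  /-- there is a fibre that is not (geometrically) smooth -/
  singular : ∃ p : PSpace k 1, ¬ Smooth (ρ.fiberToSpecResidueField p)

namespace EllipticSurface

variable (E : EllipticSurface k)

/-- `W` is a Weierstrass equation of the generic fibre. -/
def HasWeierstrassModel (W : WeierstrassCurve (RatFunc k)) : Prop :=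
  IsGenericFibre E.ρ E.σ E.section_eq W

/-- `E` is rational: its base change to an algebraic closure of `k` is birational to the
projective plane. -/
def IsRational : Prop :=
  Scheme.BirationalOver
    (pullback.snd (E.ρ ≫ PSpace.str k 1)
      (Spec.map (CommRingCat.ofHom (algebraMap k (AlgebraicClosure k)))))
    (PSpace.str (AlgebraicClosure k) 2)

/-- `E` is isotrivial: the `j`-invariant of the generic fibre, computed from any of its
Weierstrass equations, lies in `k`. -/
def IsIsotrivial : Prop :=
  ∀ (W : WeierstrassCurve (RatFunc k)) [W.IsElliptic], E.HasWeierstrassModel W →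
    ∃ c : k, W.j = algebraMap k (RatFunc k) c

end EllipticSurface

/-- The Weierstrass curve `Y² = X³ + a(T) X + b(T)` over `k(T)`. -/
def shortWeierstrass (a b : Polynomial k) : WeierstrassCurve (RatFunc k) where
  a₁ := 0
  a₂ := 0
  a₃ := 0
  a₄ := algebraMap (Polynomial k) (RatFunc k) a
  a₆ := algebraMap (Polynomial k) (RatFunc k) b

/-- `Y² = X³ + a(T) X + b(T)` is a Weierstrass equation of the generic fibre of `E` of the kind
from which the sextic hypersurface associated to `E` is formed: `deg a ≤ 4`, `deg b ≤ 6` and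
`4a³ + 27b²` is not constant. -/
structure EllipticSurface.IsSexticModel (E : EllipticSurface k) (a b : Polynomial k) : Prop where
  degree_a : a.natDegree ≤ 4
  degree_b : b.natDegree ≤ 6
  disc : ∀ c : k, 4 * a ^ 3 + 27 * b ^ 2 ≠ Polynomial.C c
  model : E.HasWeierstrassModel (shortWeierstrass a b)

/-! ### Sextic hypersurfaces in `ℙ(1,1,2,3)` -/

lemma isWeightedHomogeneous_rename {d : ℕ} {P : MvPolynomial (Fin 2) k} (hP : P.IsHomogeneous d) :
    MvPolynomial.IsWeightedHomogeneous ![1, 1, 2, 3]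
      (MvPolynomial.rename (Fin.castLE (by norm_num : 2 ≤ 4)) P) d := by
  rw [MvPolynomial.IsHomogeneous] at hP
  intro m hm
  obtain ⟨s, rfl, hs⟩ := MvPolynomial.coeff_rename_ne_zero _ _ _ hm
  have := hP hs
  rw [← this]
  rw [Finsupp.weight_apply, Finsupp.sum_mapDomain_index (by simp) (by simp [add_mul]),
    Finsupp.weight_apply]
  refine Finset.sum_congr rfl fun i _ => ?_
  fin_cases i <;> rfl

/-- The sextic form `w² - (z³ + G(x,y) z + F(x,y))` in the variables `x, y, z, w`
of weights `1, 1, 2, 3`. -/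
def sexticForm (G F : MvPolynomial (Fin 2) k) (hG : G.IsHomogeneous 4) (hF : F.IsHomogeneous 6) :
    WForm k ![1, 1, 2, 3] 6 where
  poly := MvPolynomial.X 3 ^ 2 - (MvPolynomial.X 2 ^ 3
    + MvPolynomial.rename (Fin.castLE (by norm_num : 2 ≤ 4)) G * MvPolynomial.X 2
    + MvPolynomial.rename (Fin.castLE (by norm_num : 2 ≤ 4)) F)
  homog := by
    have hX := MvPolynomial.isWeightedHomogeneous_X k ![1, 1, 2, 3]
    have h3 := (hX 3).pow 2
    have h2 := (hX 2).pow 3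
    exact Submodule.sub_mem (MvPolynomial.weightedHomogeneousSubmodule k ![1, 1, 2, 3] 6) h3
      ((h2.add ((isWeightedHomogeneous_rename hG).mul (hX 2))).add
        (isWeightedHomogeneous_rename hF))

/-- The sextic hypersurface `w² = z³ + G(x,y) z + F(x,y)` with `G(x,y) = y⁴ a(x/y)` and
`F(x,y) = y⁶ b(x/y)`. -/
def associatedSextic (a b : Polynomial k) : WForm k ![1, 1, 2, 3] 6 :=
  sexticForm (a.homogenize 4) (b.homogenize 6) (Polynomial.isHomogeneous_homogenize a)
    (Polynomial.isHomogeneous_homogenize b)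

/-- The sextic hypersurface `w² = z³ + F(x,y)`. -/
def twistSextic (F : MvPolynomial (Fin 2) k) (hF : F.IsHomogeneous 6) : WForm k ![1, 1, 2, 3] 6 :=
  sexticForm 0 F (MvPolynomial.isHomogeneous_zero _ _ _) hF

end

end RatEllSurf

end

namespace RatEllSurf

attribute [local instance] MvPolynomial.weightedGradedAlgebra

/-! Constancy of the j-invariant is a proportionality between `a³` and `b²`. If `j = 0`, it gives `a
= 0` at once. Otherwise, with `G` and `F` the homogenizations of `a` and `b`, it gives `G³ ∣ F²`. If
`G` were nonzero, it would have an irreducible factor `g`, and comparing multiplicities gives `g² ∣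
F`. At a zero `p` of `g`, the point `(p, 0, 0)` of `w² = z³ + Gz + F` is then singular,
contradicting smoothness. So `a = 0`, and the same singular points, now with `G = 0`, show that `F`
is squarefree. The given equation is therefore already of the required form.

Singularity is detected by infinitesimal lifting rather than by a Jacobian: `exists_lift` lifts
solutions along nilpotent ideals, and `not_smooth_sexticForm` exhibits a solution modulo `ε²` that
does not lift modulo `ε³`. -/

/-- Rescaling the variables according to their weights multiplies a weighted homogeneous
polynomial of degree `d` by the `d`-th power of the factor. -/
theorem aeval_pow_mul_of_isWeightedHomogeneous {R S ι : Type*} [CommRing R] [CommRing S]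
    [Algebra R S] {w : ι → ℕ} {d : ℕ} {p : MvPolynomial ι R}
    (hp : MvPolynomial.IsWeightedHomogeneous w p d) (s : S) (v : ι → S) :
    MvPolynomial.aeval (fun i => s ^ w i * v i) p = s ^ d * MvPolynomial.aeval v p := by
  simp only [MvPolynomial.aeval_def, MvPolynomial.eval₂_eq, Finset.mul_sum]
  refine Finset.sum_congr rfl fun m hm => ?_
  have hd : ∑ i ∈ m.support, w i * m i = d := by
    rw [← hp (MvPolynomial.mem_support_iff.mp hm), Finsupp.weight_apply, Finsupp.sum]
    simp [mul_comm]
  simp only [mul_pow, Finset.prod_mul_distrib, ← pow_mul, Finset.prod_pow_eq_pow_sum, hd]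
  ring

/-! ### Charts of weighted hypersurfaces and infinitesimal lifting -/

namespace WForm

variable {K : Type u} [Field K] {n : ℕ} {w : Fin n → ℕ} {d : ℕ} (f : WForm K w d)

/-- The class of the `j`-th variable in the homogeneous coordinate ring. -/
noncomputable def coord (j : Fin n) : f.CoordRing :=
  Ideal.Quotient.mkₐ K (Ideal.span {f.poly}) (MvPolynomial.X j)

theorem coord_mem (j : Fin n) : f.coord j ∈ f.grading (w j) :=
  f.mk_mem_grading (MvPolynomial.isWeightedHomogeneous_X K w j)

theorem coord_mem_smul {j : Fin n} (hj : w j = 1) (m : Fin n) :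
    f.coord m ∈ f.grading (w m • w j) := by
  simpa [hj] using f.coord_mem m

/-- The affine coordinate ring of the chart of the hypersurface where the `j`-th coordinate does
not vanish. -/
abbrev Chart (j : Fin n) : Type u := HomogeneousLocalization.Away f.grading (f.coord j)

/-- The structure map of the affine coordinate ring of a chart. -/
noncomputable def chartMap (j : Fin n) : K →+* f.Chart j :=
  (HomogeneousLocalization.fromZeroRingHom f.grading (Submonoid.powers (f.coord j))).comp
    (algebraMap K (f.grading 0))

noncomputable instance (j : Fin n) : Algebra K (f.Chart j) := (f.chartMap j).toAlgebra

/-- The inclusion of the coordinate ring of a chart into the full localization. -/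
noncomputable def chartVal (j : Fin n) : f.Chart j →ₐ[K] Localization.Away (f.coord j) :=
  { algebraMap (f.Chart j) (Localization.Away (f.coord j)) with
    commutes' := fun _ => rfl }

theorem chartVal_injective (j : Fin n) : Function.Injective (f.chartVal j) :=
  HomogeneousLocalization.val_injective _

/-- The affine coordinate `x_m / x_j ^ w_m` on the chart `x_j ≠ 0`, where `x_j` has weight `1`. -/
noncomputable def chartCoord (j : Fin n) (hj : w j = 1) (m : Fin n) : f.Chart j :=
  HomogeneousLocalization.Away.mk f.grading (f.coord_mem j) (w m) (f.coord m)
    (f.coord_mem_smul hj m)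

theorem chartVal_chartCoord (j : Fin n) (hj : w j = 1) (m : Fin n) :
    algebraMap _ _ (f.coord j) ^ w m * f.chartVal j (f.chartCoord j hj m) =
      algebraMap _ _ (f.coord m) := by
  change _ * (f.chartCoord j hj m).val = _
  rw [chartCoord, HomogeneousLocalization.Away.val_mk, Localization.mk_eq_mk', ← map_pow]
  exact IsLocalization.mk'_spec' _ (f.coord m)
    (⟨f.coord j ^ w m, w m, rfl⟩ : Submonoid.powers (f.coord j))

theorem aeval_coord : MvPolynomial.aeval f.coord f.poly = 0 := by
  have : MvPolynomial.aeval f.coord = Ideal.Quotient.mkₐ K (Ideal.span {f.poly}) :=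
    MvPolynomial.algHom_ext fun j => by simp [coord]
  rw [this]
  exact Ideal.Quotient.eq_zero_iff_mem.mpr (Ideal.mem_span_singleton_self _)

/-- The chart embeds in the full localization. There, rescaling by `x_j` turns the value at the
chart coordinates into the value at the homogeneous coordinates, which is zero, up to the unit `x_j
^ d`. -/
theorem aeval_chartCoord (j : Fin n) (hj : w j = 1) :
    MvPolynomial.aeval (f.chartCoord j hj) f.poly = 0 := by
  apply f.chartVal_injective j
  have hu : IsUnit (algebraMap f.CoordRing (Localization.Away (f.coord j)) (f.coord j)) :=
    IsLocalization.Away.algebraMap_isUnit _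
  have h := aeval_pow_mul_of_isWeightedHomogeneous f.homog
    (algebraMap f.CoordRing (Localization.Away (f.coord j)) (f.coord j))
    (fun m => f.chartVal j (f.chartCoord j hj m))
  simp only [chartVal_chartCoord] at h
  have h0 := MvPolynomial.aeval_algebraMap_apply (Localization.Away (f.coord j)) f.coord f.poly
  rw [aeval_coord, map_zero] at h0
  have h' := (hu.pow d).mul_right_eq_zero.mp (h.symm.trans h0)
  rw [map_zero]
  refine Eq.trans ?_ h'
  exact MvPolynomial.comp_aeval_apply _ (f.chartVal j) f.poly

/-- The chart is an open subscheme, so it inherits smoothness. Both it and the base are affine,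
which makes this a property of the ring map `chartMap`. -/
theorem formallySmooth_chart [Smooth f.str] (j : Fin n) (hj : w j = 1) :
    Algebra.FormallySmooth K (f.Chart j) := by
  have h0 : 0 < w j := by omega
  have h : Smooth (Proj.awayι f.grading (f.coord j) (f.coord_mem j) h0 ≫ f.str) := inferInstance
  rw [str, projStr, Proj.awayι_toSpecZero_assoc, ← Spec.map_comp,
    HasRingHomProperty.Spec_iff (P := @Smooth)] at h
  have h' : (f.chartMap j).Smooth := h
  exact h'.formallySmooth

/-- Infinitesimal lifting for cones over smooth hypersurfaces in weighted projective spaces, away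
from the zero set of a coordinate of weight one. -/
theorem exists_lift [Smooth f.str] {S : Type u} [CommRing S] [Algebra K S] {I : Ideal S}
    (hI : IsNilpotent I) {j : Fin n} (hj : w j = 1) (v : Fin n → S) (hv : IsUnit (v j))
    (hf : MvPolynomial.aeval v f.poly ∈ I) :
    ∃ v' : Fin n → S, (∀ m, v' m - v m ∈ I) ∧ MvPolynomial.aeval v' f.poly = 0 := by
  have := f.formallySmooth_chart j hj
  have hker : ∀ a ∈ Ideal.span {f.poly},
      MvPolynomial.aeval (fun m => Ideal.Quotient.mkₐ K I (v m)) a = 0 := by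
    intro a ha
    obtain ⟨b, rfl⟩ := Ideal.mem_span_singleton.mp ha
    have : MvPolynomial.aeval (fun m => Ideal.Quotient.mkₐ K I (v m)) f.poly = 0 := by
      rw [← MvPolynomial.comp_aeval_apply]
      exact Ideal.Quotient.eq_zero_iff_mem.mpr hf
    rw [map_mul, this, zero_mul]
  let g : f.CoordRing →ₐ[K] S ⧸ I := Ideal.Quotient.liftₐ _ _ hker
  have hg : ∀ m, g (f.coord m) = Ideal.Quotient.mkₐ K I (v m) := fun m => by
    change MvPolynomial.aeval (fun m => Ideal.Quotient.mkₐ K I (v m)) (MvPolynomial.X m) = _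
    simp
  have hu : IsUnit (g (f.coord j)) := by rw [hg]; exact hv.map _
  let χ' : Localization.Away (f.coord j) →+* S ⧸ I :=
    IsLocalization.Away.lift (f.coord j) (g := g.toRingHom) hu
  have hχ' : ∀ x, χ' (algebraMap _ _ x) = g x :=
    fun x => IsLocalization.Away.lift_eq (f.coord j) (g := g.toRingHom) hu x
  let χ : f.Chart j →ₐ[K] S ⧸ I :=
    { χ'.comp (f.chartVal j).toRingHom with
      commutes' := fun c => by
        change χ' (f.chartVal j (algebraMap K _ c)) = _
        rw [AlgHom.commutes, IsScalarTower.algebraMap_apply K f.CoordRing, hχ', AlgHom.commutes] }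
  have hχ : ∀ m, Ideal.Quotient.mkₐ K I (v j) ^ w m * χ (f.chartCoord j hj m) =
      Ideal.Quotient.mkₐ K I (v m) := fun m => by
    change _ * χ' (f.chartVal j _) = _
    rw [← hg, ← hg, ← hχ', ← hχ', ← map_pow, ← map_mul, chartVal_chartCoord]
  obtain ⟨ψ, hψ⟩ := Algebra.FormallySmooth.exists_lift I hI χ
  -- The lifted chart point is moved back to the cone with scaling factor `v j`, which lies over the
  -- right class modulo `I`.
  refine ⟨fun m => v j ^ w m * ψ (f.chartCoord j hj m), fun m => ?_, ?_⟩
  · rw [← Ideal.Quotient.eq]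
    have := hχ m
    rw [← hψ] at this
    simpa using this
  · rw [aeval_pow_mul_of_isWeightedHomogeneous f.homog,
      ← MvPolynomial.comp_aeval_apply, aeval_chartCoord, map_zero, mul_zero]

end WForm

/-! ### Multiple factors and singular points of sextics -/

/-- A bivariate polynomial that is not a unit vanishes at a point other than the origin, over the
algebraic closure. -/
theorem exists_aeval_eq_zero_of_not_isUnit {k : Type u} [Field k] {g : MvPolynomial (Fin 2) k}
    (hg : ¬ IsUnit g) :
    ∃ p : Fin 2 → AlgebraicClosure k, p ≠ 0 ∧ MvPolynomial.aeval p g = 0 := by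
  by_contra! H
  let L := AlgebraicClosure k
  -- A root-free polynomial over an algebraically closed field is constant. Applied on horizontal
  -- and vertical lines missing the origin, this makes `g` constant wherever both coordinates are
  -- nonzero.
  have key : ∀ q : Polynomial L, (∀ t, q.eval t ≠ 0) → ∀ s t, q.eval s = q.eval t := by
    intro q hq s t
    have hd : q.degree = 0 := by
      by_contra hd
      obtain ⟨x, hx⟩ := IsAlgClosed.exists_root q hd
      exact hq x hx
    rw [Polynomial.eq_C_of_degree_eq_zero hd, Polynomial.eval_C, Polynomial.eval_C]
  have ev0 : ∀ s t : L, Polynomial.eval s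
      (MvPolynomial.aeval ![Polynomial.X, Polynomial.C t] g) = MvPolynomial.aeval ![s, t] g := by
    intro s t
    rw [← Polynomial.coe_aeval_eq_eval, ← AlgHom.restrictScalars_apply k,
      MvPolynomial.comp_aeval_apply]
    congr 2
    ext i; fin_cases i <;> simp
  have ev1 : ∀ s t : L, Polynomial.eval t
      (MvPolynomial.aeval ![Polynomial.C s, Polynomial.X] g) = MvPolynomial.aeval ![s, t] g := by
    intro s t
    rw [← Polynomial.coe_aeval_eq_eval, ← AlgHom.restrictScalars_apply k,
      MvPolynomial.comp_aeval_apply]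
    congr 2
    ext i; fin_cases i <;> simp
  have h0 : ∀ t : L, t ≠ 0 → ∀ s s' : L,
      MvPolynomial.aeval ![s, t] g = MvPolynomial.aeval ![s', t] g := by
    intro t ht s s'
    rw [← ev0, ← ev0]
    refine key _ (fun x => ?_) s s'
    rw [ev0]
    exact H _ fun h => ht (congrFun h 1)
  have h1 : ∀ s : L, s ≠ 0 → ∀ t t' : L,
      MvPolynomial.aeval ![s, t] g = MvPolynomial.aeval ![s, t'] g := by
    intro s hs t t'
    rw [← ev1, ← ev1]
    refine key _ (fun x => ?_) t t'
    rw [ev1]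
    exact H _ fun h => hs (congrFun h 0)
  let c : L := MvPolynomial.aeval ![1, 1] g
  -- The factor `X 0 * X 1` absorbs the axes, so that the product vanishes at every point of an
  -- infinite field.
  have hconst : (MvPolynomial.X 0 * MvPolynomial.X 1) *
      (MvPolynomial.map (algebraMap k L) g - MvPolynomial.C c) = 0 := by
    refine MvPolynomial.funext fun x => ?_
    have hx : x = ![x 0, x 1] := by ext i; fin_cases i <;> rfl
    simp only [map_mul, map_sub, MvPolynomial.eval_X, MvPolynomial.eval_C, map_zero, mul_eq_zero,
      MvPolynomial.eval_map, ← MvPolynomial.aeval_def]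
    by_cases hx0 : x 0 = 0
    · exact Or.inl (Or.inl hx0)
    by_cases hx1 : x 1 = 0
    · exact Or.inl (Or.inr hx1)
    · right
      rw [sub_eq_zero, hx, h0 _ hx1 (x 0) 1, h1 1 one_ne_zero (x 1) 1]
  have hmap : MvPolynomial.map (algebraMap k L) g = MvPolynomial.C c := by
    have := (mul_eq_zero.mp hconst).resolve_left
      (mul_ne_zero (MvPolynomial.X_ne_zero _) (MvPolynomial.X_ne_zero _))
    exact sub_eq_zero.mp this
  have hgC : g = MvPolynomial.C (g.coeff 0) := by
    ext m
    have hm := congrArg (MvPolynomial.coeff m) hmap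
    rw [MvPolynomial.coeff_map, MvPolynomial.coeff_C] at hm
    rw [MvPolynomial.coeff_C]
    split_ifs with h
    · rw [h]
    · rw [if_neg h] at hm
      exact (map_eq_zero _).mp hm
  refine hg ?_
  rw [hgC]
  refine IsUnit.map MvPolynomial.C (isUnit_iff_ne_zero.mpr fun h => ?_)
  rw [h, map_zero] at hgC
  exact H 1 one_ne_zero (by rw [hgC, map_zero])

/-- If a form `g` divides `G` and its square divides `F`, then the hypersurface
`w² = z³ + G(x,y) z + F(x,y)` is singular at the zeros of `g` on the line `z = w = 0`. -/
theorem not_smooth_sexticForm {k : Type u} [Field k] {G F g : MvPolynomial (Fin 2) k}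
    (hG : G.IsHomogeneous 4) (hF : F.IsHomogeneous 6) (hgG : g ∣ G) (hgF : g * g ∣ F)
    {L : Type u} [Field L] [Algebra k L] {p : Fin 2 → L} (hp : p ≠ 0)
    (hgp : MvPolynomial.aeval p g = 0) : ¬ Smooth (sexticForm G F hG hF).str := by
  intro hs
  obtain ⟨j, hj⟩ := Function.ne_iff.mp hp
  -- The test ring is `L[ε]/(ε³)` with the square-zero ideal `(ε²)`.
  let S := AdjoinRoot (Polynomial.X ^ 3 : Polynomial L)
  let ε : S := AdjoinRoot.root _
  have hε : ε ^ 3 = 0 := by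
    have := AdjoinRoot.mk_self (f := (Polynomial.X ^ 3 : Polynomial L))
    rwa [map_pow, AdjoinRoot.mk_X] at this
  have hε2 : ε ^ 2 ≠ 0 := by
    intro h
    have h' : AdjoinRoot.mk (Polynomial.X ^ 3 : Polynomial L) (Polynomial.X ^ 2) = 0 := by
      simpa using h
    rw [AdjoinRoot.mk_eq_zero, Polynomial.X_pow_dvd_iff] at h'
    simpa using h' 2 (by norm_num)
  let I : Ideal S := Ideal.span {ε ^ 2}
  have hmul : ∀ x ∈ I, ∀ y ∈ I, x * y = 0 := by
    intro x hx y hy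
    obtain ⟨x, rfl⟩ := Ideal.mem_span_singleton.mp hx
    obtain ⟨y, rfl⟩ := Ideal.mem_span_singleton.mp hy
    linear_combination x * y * ε * hε
  have hI : IsNilpotent I := ⟨2, by
    rw [pow_two, Ideal.zero_eq_bot, eq_bot_iff, Ideal.mul_le]
    exact fun x hx y hy => hmul x hx y hy⟩
  obtain ⟨G', rfl⟩ := hgG
  obtain ⟨F', rfl⟩ := hgF
  let P : Fin 2 → S := fun i => algebraMap L S (p i)
  have hgP : MvPolynomial.aeval P g = 0 := by
    have := MvPolynomial.aeval_algebraMap_apply S p g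
    rw [hgp, map_zero] at this
    exact this
  -- A tangent vector in the `w`-direction: the equation takes the value `ε²` on it, so it holds
  -- modulo `I`.
  let v : Fin 4 → S := ![P 0, P 1, 0, ε]
  have hren : ∀ (v : Fin 4 → S) (Q : MvPolynomial (Fin 2) k),
      MvPolynomial.aeval v (MvPolynomial.rename (Fin.castLE (by norm_num : 2 ≤ 4)) Q) =
        MvPolynomial.aeval ![v 0, v 1] Q := by
    intro v Q
    rw [MvPolynomial.aeval_rename]
    congr 2
    ext i; fin_cases i <;> rfl
  have hpoly : ∀ v : Fin 4 → S,
      MvPolynomial.aeval v (sexticForm (g * G') (g * g * F') hG hF).poly =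
        v 3 ^ 2 - (v 2 ^ 3 + MvPolynomial.aeval ![v 0, v 1] g *
          MvPolynomial.aeval ![v 0, v 1] G' * v 2 +
          MvPolynomial.aeval ![v 0, v 1] g * MvPolynomial.aeval ![v 0, v 1] g *
            MvPolynomial.aeval ![v 0, v 1] F') := by
    intro v
    simp only [sexticForm, map_sub, map_add, map_mul, map_pow, MvPolynomial.aeval_X, hren]
  have hPv : ![P 0, P 1] = P := by ext i; fin_cases i <;> rfl
  have hv : MvPolynomial.aeval v (sexticForm (g * G') (g * g * F') hG hF).poly ∈ I := by
    rw [hpoly]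
    change ε ^ 2 - (0 ^ 3 + MvPolynomial.aeval ![P 0, P 1] g * _ * 0 +
      MvPolynomial.aeval ![P 0, P 1] g * _ * _) ∈ I
    rw [hPv, hgP]
    convert Ideal.mem_span_singleton_self (ε ^ 2) using 1
    ring
  have hunit : IsUnit (v (Fin.castLE (by norm_num : 2 ≤ 4) j)) := by
    have : v (Fin.castLE (by norm_num : 2 ≤ 4) j) = algebraMap L S (p j) := by
      fin_cases j <;> rfl
    rw [this]
    exact (isUnit_iff_ne_zero.mpr hj).map _
  have hw : (![1, 1, 2, 3] : Fin 4 → ℕ) (Fin.castLE (by norm_num : 2 ≤ 4) j) = 1 := by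
    fin_cases j <;> rfl
  obtain ⟨v', hv', hzero⟩ := (sexticForm (g * G') (g * g * F') hG hF).exists_lift hI hw v hunit hv
  rw [hpoly] at hzero
  have hgI : MvPolynomial.aeval ![v' 0, v' 1] g ∈ I := by
    rw [← Ideal.Quotient.eq_zero_iff_mem]
    have e1 := MvPolynomial.comp_aeval_apply (f := ![v' 0, v' 1]) (Ideal.Quotient.mkₐ k I) g
    have e2 := MvPolynomial.comp_aeval_apply (f := P) (Ideal.Quotient.mkₐ k I) g
    rw [hgP, map_zero] at e2
    refine e1.trans (Eq.trans ?_ e2.symm)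
    congr 2
    ext i
    fin_cases i
    · exact Ideal.Quotient.eq.mpr (hv' 0)
    · exact Ideal.Quotient.eq.mpr (hv' 1)
  have h2 : v' 2 ∈ I := by simpa [v] using hv' 2
  have h3 : v' 3 - ε ∈ I := hv' 3
  obtain ⟨u, hu⟩ := Ideal.mem_span_singleton.mp h3
  refine hε2 ?_
  -- For a lift, `g` and `z` lie in `I`, so `z³`, `gG'z` and `g²F'` vanish because `I² = 0`. Since
  -- `w = ε + ε²u`, also `w² = ε²`, and the equation reduces to `ε² = 0`.
  linear_combination hzero + v' 2 * hmul _ h2 _ h2 +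
    MvPolynomial.aeval ![v' 0, v' 1] G' * hmul _ hgI _ h2 +
    MvPolynomial.aeval ![v' 0, v' 1] F' * hmul _ hgI _ hgI
    - (v' 3 + ε) * hu - u * 2 * hε - ε * u * (u * hε) - ε ^ 2 * u * hu

/-- If `w² = z³ + G(x,y) z + F(x,y)` is smooth and `G³` divides `F²`, then `G = 0`. -/
theorem eq_zero_of_smooth_sexticForm {k : Type u} [Field k] {G F : MvPolynomial (Fin 2) k}
    (hG : G.IsHomogeneous 4) (hF : F.IsHomogeneous 6) (hdvd : G ^ 3 ∣ F ^ 2)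
    (hs : Smooth (sexticForm G F hG hF).str) : G = 0 := by
  by_contra h0
  have hGu : ¬ IsUnit G := fun h => by
    have h1 := h.map (MvPolynomial.constantCoeff (σ := Fin 2) (R := k))
    rw [MvPolynomial.constantCoeff_eq, hG.coeff_eq_zero (by simp)] at h1
    exact not_isUnit_zero h1
  obtain ⟨g, hg, hgG⟩ := WfDvdMonoid.exists_irreducible_factor hGu h0
  have hgp : Prime g := hg.prime
  have h3 : g ^ 3 ∣ F ^ 2 := (pow_dvd_pow_of_dvd hgG 3).trans hdvd
  obtain ⟨F₁, rfl⟩ : g ∣ F := hgp.dvd_of_dvd_pow ((dvd_pow_self g (by norm_num)).trans h3)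
  -- The multiplicity of `g` in `F²` is even and at least 3, so `g` divides `F` twice.
  have h4 : g ∣ F₁ := by
    refine hgp.dvd_of_dvd_pow (n := 2) ?_
    have h5 : g ^ 2 * g ∣ g ^ 2 * F₁ ^ 2 := by rwa [← mul_pow, ← pow_succ]
    exact (mul_dvd_mul_iff_left (pow_ne_zero 2 hgp.ne_zero)).mp h5
  obtain ⟨p, hp, hpg⟩ := exists_aeval_eq_zero_of_not_isUnit hg.not_isUnit
  exact not_smooth_sexticForm hG hF hgG (mul_dvd_mul_left g h4) hp hpg hs

/-- Every `g` divides `G = 0`, so any nonunit whose square divides `F` already produces a singular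
point. -/
theorem squarefree_of_smooth_sexticForm_zero {k : Type u} [Field k] {F : MvPolynomial (Fin 2) k}
    (hG : (0 : MvPolynomial (Fin 2) k).IsHomogeneous 4) (hF : F.IsHomogeneous 6)
    (hs : Smooth (sexticForm 0 F hG hF).str) : Squarefree F := by
  intro g hg
  by_contra hu
  obtain ⟨p, hp, hpg⟩ := exists_aeval_eq_zero_of_not_isUnit hu
  exact not_smooth_sexticForm hG hF (dvd_zero g) hg hp hpg hs

/-! ### Dehomogenization and the j-invariant -/

/-- A polynomial whose homogenization is squarefree is squarefree. -/
theorem squarefree_of_squarefree_homogenize {k : Type u} [Field k] {b : Polynomial k} {n : ℕ}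
    (hb : b.natDegree ≤ n) (h : Squarefree (b.homogenize n)) : Squarefree b := by
  rintro d ⟨e, rfl⟩
  by_cases h0 : d * d * e = 0
  · rw [h0, Polynomial.homogenize_zero] at h
    exact absurd h not_squarefree_zero
  have hd0 : d ≠ 0 := by rintro rfl; simp at h0
  have he0 : e ≠ 0 := by rintro rfl; simp at h0
  rw [Polynomial.natDegree_mul (mul_ne_zero hd0 hd0) he0] at hb
  have hn : n = (d.natDegree + d.natDegree) + (n - (d.natDegree + d.natDegree)) := by
    rw [Polynomial.natDegree_mul hd0 hd0] at hb
    omega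
  -- `d` is homogenized in its exact degree; the cofactor `e` takes all the remaining degree,
  -- including any power of the second variable. Setting that variable to 1 then recovers `d` as a
  -- unit.
  have hd := h (d.homogenize d.natDegree) ⟨e.homogenize (n - (d.natDegree + d.natDegree)), by
    rw [← Polynomial.homogenize_mul _ _ le_rfl le_rfl,
      ← Polynomial.homogenize_mul _ _ Polynomial.natDegree_mul_le, ← hn]
    rw [Polynomial.natDegree_mul hd0 hd0] at hb
    omega⟩
  have := hd.map (MvPolynomial.aeval (R := k) ![(Polynomial.X : Polynomial k), 1])
  rwa [Polynomial.aeval_homogenize_X_one _ le_rfl] at this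

theorem Δ_shortWeierstrass {k : Type u} [Field k] (a b : Polynomial k) :
    (shortWeierstrass a b).Δ =
      algebraMap (Polynomial k) (RatFunc k) (-16 * (4 * a ^ 3 + 27 * b ^ 2)) := by
  simp only [shortWeierstrass, WeierstrassCurve.Δ, WeierstrassCurve.b₂, WeierstrassCurve.b₄,
    WeierstrassCurve.b₆, WeierstrassCurve.b₈, map_mul, map_add, map_pow, map_neg, map_ofNat]
  ring

theorem c₄_shortWeierstrass {k : Type u} [Field k] (a b : Polynomial k) :
    (shortWeierstrass a b).c₄ = algebraMap (Polynomial k) (RatFunc k) (-48 * a) := by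
  simp only [shortWeierstrass, WeierstrassCurve.c₄, WeierstrassCurve.b₂, WeierstrassCurve.b₄,
    map_mul, map_neg, map_ofNat]
  ring

/-- If the `j`-invariant of `Y² = X³ + a X + b` is the constant `c`, then `a³` and `b²` are
proportional. -/
theorem cube_mul_eq_of_j_eq {k : Type u} [Field k] [CharZero k] {a b : Polynomial k}
    [(shortWeierstrass a b).IsElliptic] {c : k}
    (hc : (shortWeierstrass a b).j = algebraMap k (RatFunc k) c) :
    Polynomial.C (1728 * 4 - 4 * c) * a ^ 3 = Polynomial.C (27 * c) * b ^ 2 := by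
  have h : (shortWeierstrass a b).c₄ ^ 3 =
      algebraMap k (RatFunc k) c * (shortWeierstrass a b).Δ := by
    rw [← hc, WeierstrassCurve.j, ← WeierstrassCurve.coe_Δ', mul_right_comm, Units.inv_mul, one_mul]
  rw [Δ_shortWeierstrass, c₄_shortWeierstrass,
    IsScalarTower.algebraMap_apply k (Polynomial k) (RatFunc k), ← map_pow, ← map_mul] at h
  have h' := RatFunc.algebraMap_injective k h
  rw [Polynomial.algebraMap_eq] at h'
  have h16 : (16 : Polynomial k) ≠ 0 := OfNat.ofNat_ne_zero 16
  apply mul_left_cancel₀ h16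
  simp only [map_sub, map_mul, map_ofNat]
  linear_combination -h'

end RatEllSurf

/-! ### The main theorem -/

theorem mainTheorem11 {k : Type u} [Field k] [NumberField k]
    (E : RatEllSurf.EllipticSurface k) (hrat : E.IsRational) (hiso : E.IsIsotrivial)
    (a b : Polynomial k) (hab : E.IsSexticModel a b)
    (hX : Smooth (RatEllSurf.associatedSextic a b).str) :
    ∃ (F : MvPolynomial (Fin 2) k) (hF : F.IsHomogeneous 6),
      Squarefree F ∧
      (∃ e : (RatEllSurf.associatedSextic a b).hypersurface ≅
          (RatEllSurf.twistSextic F hF).hypersurface,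
        e.hom ≫ (RatEllSurf.twistSextic F hF).str = (RatEllSurf.associatedSextic a b).str) ∧
      ∃ f : Polynomial k, f = MvPolynomial.aeval ![Polynomial.X, 1] F ∧
        Squarefree f ∧ ¬ IsSquare f ∧ 1 ≤ f.natDegree ∧ f.natDegree ≤ 6 ∧
        E.HasWeierstrassModel (RatEllSurf.shortWeierstrass 0 f) := by
  have hΔ0 : 4 * a ^ 3 + 27 * b ^ 2 ≠ 0 := by simpa using hab.disc 0
  have hell : (RatEllSurf.shortWeierstrass a b).IsElliptic := by
    refine ⟨isUnit_iff_ne_zero.mpr ?_⟩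
    rw [RatEllSurf.Δ_shortWeierstrass]
    exact (map_ne_zero_iff _ (RatFunc.algebraMap_injective k)).mpr
      (mul_ne_zero (neg_ne_zero.mpr (OfNat.ofNat_ne_zero 16)) hΔ0)
  obtain ⟨c, hc⟩ := hiso _ hab.model
  have hprop := RatEllSurf.cube_mul_eq_of_j_eq hc
  have ha : a = 0 := by
    by_cases hc0 : c = 0
    · simpa [hc0] using hprop
    · rw [← Polynomial.homogenize_eq_zero_iff hab.degree_a]
      refine RatEllSurf.eq_zero_of_smooth_sexticForm (Polynomial.isHomogeneous_homogenize a)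
        (Polynomial.isHomogeneous_homogenize b) ?_ hX
      have hG : (a ^ 3).homogenize 12 = a.homogenize 4 ^ 3 := by
        have h2 : (a ^ 2).natDegree ≤ 8 :=
          Polynomial.natDegree_pow_le.trans (Nat.mul_le_mul_left 2 hab.degree_a)
        rw [pow_succ, Polynomial.homogenize_mul (m := 8) (n := 4) _ _ h2 hab.degree_a, pow_two,
          Polynomial.homogenize_mul (m := 4) (n := 4) _ _ hab.degree_a hab.degree_a]
        ring
      have hF : (b ^ 2).homogenize 12 = b.homogenize 6 ^ 2 := by
        rw [pow_two, Polynomial.homogenize_mul (m := 6) (n := 6) _ _ hab.degree_b hab.degree_b,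
          pow_two]
      have h := congrArg (Polynomial.homogenize · 12) hprop
      simp only [Polynomial.homogenize_C_mul, hG, hF] at h
      have hu : IsUnit (MvPolynomial.C (27 * c) : MvPolynomial (Fin 2) k) :=
        (isUnit_iff_ne_zero.mpr (mul_ne_zero (OfNat.ofNat_ne_zero 27) hc0)).map MvPolynomial.C
      -- Only `27c` has to be invertible: if the coefficient of `a³` vanishes (`c = 1728`), the
      -- divisibility still holds, with `F = 0`.
      exact hu.dvd_mul_left.mp (h ▸ dvd_mul_left _ _)
  subst ha
  have hXeq : RatEllSurf.associatedSextic 0 b =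
      RatEllSurf.twistSextic (b.homogenize 6) (Polynomial.isHomogeneous_homogenize b) := by
    simp only [RatEllSurf.associatedSextic, RatEllSurf.twistSextic, Polynomial.homogenize_zero]
  rw [hXeq] at hX ⊢
  have hsqF : Squarefree (b.homogenize 6) :=
    RatEllSurf.squarefree_of_smooth_sexticForm_zero _ _ hX
  have hsq : Squarefree b := RatEllSurf.squarefree_of_squarefree_homogenize hab.degree_b hsqF
  have hdeg : 1 ≤ b.natDegree := by
    by_contra hd
    obtain ⟨r, rfl⟩ := Polynomial.natDegree_eq_zero.mp (by omega : b.natDegree = 0)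
    exact hab.disc (27 * r ^ 2) (by rw [map_mul, map_pow, map_ofNat]; ring)
  refine ⟨b.homogenize 6, Polynomial.isHomogeneous_homogenize b, hsqF, ⟨Iso.refl _, ?_⟩,
    b, (Polynomial.aeval_homogenize_X_one b hab.degree_b).symm, hsq, ?_, hdeg, hab.degree_b,
    hab.model⟩
  · exact Category.id_comp _
  · rintro ⟨d, rfl⟩
    -- A squarefree square is a unit, contradicting the positive degree.
    have hd := hsq d dvd_rfl
    rw [Polynomial.natDegree_eq_zero_of_isUnit (hd.mul hd)] at hdeg
    omega
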